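/- Let $M \subseteq \mathbb{R}^n$ be a non-empty properly embedded (equivalently, closed) $m$-dimensional $\mathcal{C}^1$-submanifold without boundary. Its medial axis $\Delta_M$ is the set of points of $\mathbb{R}^n$ whose distance to $M$ is attained in at least two points of $M$. Assume that its reach $\tau = d(M, \Delta_M)$ satisfies $0 < \tau < \infty$ (if $\Delta_M = \emptyset$, the reach is $\infty$ by convention). Let $S \subseteq M$ be non-empty and locally finite in $\mathbb{R}^n$, such that the Hausdorff distance $\varkappa$ between $S$ and $M$ is finite. For $p > 0$ and $X \in M$ let $E_p(X)$ be the open ellipsoid centered at $X$ with tangent semi-axes of length $\sqrt{\tau p + p^2}$ and normal semi-axes of length $p$, that is, the set of $Y \in \mathbb{R}^n$ with $$\frac{\|a\|^2}{\tau p + p^2} + \frac{\|b\|^2}{p^2} < 1,$$ where $a$ and $b$ are the orthogonal projections of $Y - X$ to the tangent and to the normal space of $M$ at $X$. Then there is a unique real number $\lambda \geq 0$ such that for all $p > 0$ $$\varkappa < \sqrt{2p\big(\sqrt{\tau (p + 2\tau)} - \tau\big)} \iff \lambda < p,$$ and for every $p$ with $\lambda < p < \tau$ the union $\mathcal{E}_p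 = \bigcup_{X \in S} E_p(X)$ satisfies $$M \subseteq \mathcal{E}_p, \qquad \mathcal{E}_p \cap \Delta_M = \emptyset, \qquad \mathcal{E}_p \subseteq \{Y \in \mathbb{R}^n : d(M, Y) < \tau\}.$$ -/

import Mathlib

open Set Filter Topology
open scoped ENNReal

/-- `M` is an `m`-dimensional embedded `C¹`-submanifold without boundary of the Euclidean space
`ℝⁿ`: around each of its points there is a `C¹`-diffeomorphism between open subsets of `ℝⁿ` which
straightens `M` to an `m`-dimensional linear subspace. -/
def IsC1Submanifold {n : ℕ} (m : ℕ) (M : Set (EuclideanSpace ℝ (Fin n))) : Prop :=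
  ∀ x ∈ M, ∃ (L : Submodule ℝ (EuclideanSpace ℝ (Fin n)))
    (e : OpenPartialHomeomorph (EuclideanSpace ℝ (Fin n)) (EuclideanSpace ℝ (Fin n))),
    Module.finrank ℝ L = m ∧ x ∈ e.source ∧
    ContDiffOn ℝ 1 e e.source ∧ ContDiffOn ℝ 1 e.symm e.target ∧
    ∀ y ∈ e.source, y ∈ M ↔ e y ∈ L

/-- The tangent space of `M` at `x`, as a linear subspace of `ℝⁿ`: it consists of the velocities at
`x` of curves in `M`. (For a `C¹`-submanifold without boundary these velocities already form a
linear subspace, so that taking the span adds nothing.) -/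
noncomputable def tangentDirections {n : ℕ} (M : Set (EuclideanSpace ℝ (Fin n)))
    (x : EuclideanSpace ℝ (Fin n)) : Submodule ℝ (EuclideanSpace ℝ (Fin n)) :=
  Submodule.span ℝ {v | ∃ γ : ℝ → EuclideanSpace ℝ (Fin n),
    γ 0 = x ∧ (∀ᶠ t in 𝓝 0, γ t ∈ M) ∧ HasDerivAt γ v 0}

/-- The normal space of `M` at `x`, as a linear subspace of `ℝⁿ`. -/
noncomputable def normalDirections {n : ℕ} (M : Set (EuclideanSpace ℝ (Fin n)))
    (x : EuclideanSpace ℝ (Fin n)) : Submodule ℝ (EuclideanSpace ℝ (Fin n)) :=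
  (tangentDirections M x)ᗮ

/-- The medial axis of `M`: the points whose distance to `M` is attained in at least two points. -/
def medialAxis {n : ℕ} (M : Set (EuclideanSpace ℝ (Fin n))) : Set (EuclideanSpace ℝ (Fin n)) :=
  {x | ∃ y' ∈ M, ∃ y'' ∈ M, y' ≠ y'' ∧
    dist x y' = Metric.infDist x M ∧ dist x y'' = Metric.infDist x M}

/-- The reach of `M`: the distance between `M` and its medial axis. It is `∞` if the medial axis is
empty. -/
noncomputable def reach {n : ℕ} (M : Set (EuclideanSpace ℝ (Fin n))) : ℝ≥0∞ :=
  ⨅ x ∈ M, ⨅ y ∈ medialAxis M, edist x y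

open scoped Classical in
/-- The tangent-normal open `p`-ellipsoid of `M` at `x`. With `τ` the reach of `M`, its tangent
semi-axes have length `√(τ p + p²)` and its normal semi-axes have length `p`; if `τ = ∞`, it is the
open `p`-thickening of the affine tangent space. -/
noncomputable def openEllipsoid {n : ℕ} (M : Set (EuclideanSpace ℝ (Fin n))) (p : ℝ)
    (x : EuclideanSpace ℝ (Fin n)) : Set (EuclideanSpace ℝ (Fin n)) :=
  if reach M = ∞ then
    {y | ‖(normalDirections M x).starProjection (y - x)‖ < p}
  else
    {y | ‖(tangentDirections M x).starProjection (y - x)‖ ^ 2 / ((reach M).toReal * p + p ^ 2)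
      + ‖(normalDirections M x).starProjection (y - x)‖ ^ 2 / p ^ 2 < 1}

/-- The union of the tangent-normal open `p`-ellipsoids of `M` centered at the points of `S`. -/
def ellipsoidUnion {n : ℕ} (M S : Set (EuclideanSpace ℝ (Fin n))) (p : ℝ) :
    Set (EuclideanSpace ℝ (Fin n)) :=
  ⋃ s ∈ S, openEllipsoid M p s

/-- `S` is locally finite in `ℝⁿ`: each point of `ℝⁿ` has a neighbourhood that contains only
finitely many points of `S`. -/
def IsLocallyFiniteSet {n : ℕ} (S : Set (EuclideanSpace ℝ (Fin n))) : Prop :=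
  ∀ x, ∃ U ∈ 𝓝 x, (U ∩ S).Finite

/-- `lam ≥ 0` is the lower bound on the persistence parameter for reach `τ` and Hausdorff distance
`κ`: a parameter `p > 0` satisfies `κ < √(2 p (√(τ (p + 2 τ)) - τ))` exactly when `lam < p`. -/
def IsPersistenceLowerBound (τ κ lam : ℝ) : Prop :=
  0 ≤ lam ∧ ∀ p : ℝ, 0 < p →
    (κ < Real.sqrt (2 * p * (Real.sqrt (τ * (p + 2 * τ)) - τ)) ↔ lam < p)

/-! Two inequalities carry the proof. The reach gives Federer's bound: for `x, z ∈ M`, the normal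
component at `x` of `z - x` has norm at most `‖z - x‖² / (2τ)` (`norm_normal_starProjection_le`).
Equivalently, open balls of radius `τ` tangent to `M` miss `M`.

Covering: a point of `M` lies within the given bound of some sample point. Federer's bound limits
the normal part of the chord, and the square root in the statement is exactly what then forces the
chord into the ellipsoid (`ellipse_of_sq_lt`).

Both remaining claims reduce to `infDist y M < τ` on the ellipsoids, since the medial axis has
distance at least `τ` from `M`. For `p < τ` an ellipsoid lies in the region `‖y - x‖² + 2τ‖b‖ <
3τ²`, with `b` the normal component of `y - x` (`sq_add_lt_of_ellipse`). Give the squared distance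
the weight `1 + δ` and minimize the left side over `x ∈ M`. At a minimizer `z` the tangent component
vanishes (`tangent_eq_zero_of_min`), so `d = ‖y - z‖` satisfies `d² + 2τd < 3τ²`, that is, `d < τ`.
As `M` is only `C¹`, no curvature is available; Federer's bound at both ends of a chord replaces it
(`normal_variation`). -/

/-! ### Nearest points and the distance function below the reach -/

section Reach

variable {n : ℕ} {M : Set (EuclideanSpace ℝ (Fin n))} {τ : ℝ}

lemma le_infDist_of_mem_medialAxis (hne : M.Nonempty) (hτ : reach M = ENNReal.ofReal τ)
    {q : EuclideanSpace ℝ (Fin n)} (hq : q ∈ medialAxis M) : τ ≤ Metric.infDist q M := by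
  rw [Metric.le_infDist hne]
  intro x hx
  have h : reach M ≤ edist x q := iInf₂_le_of_le x hx (iInf₂_le q hq)
  rw [hτ, edist_dist, ENNReal.ofReal_le_ofReal_iff dist_nonneg, dist_comm] at h
  exact h

/-- Nearest points depend continuously on the point at which the nearest point is unique. -/
lemma tendsto_nearest (hM : IsClosed M) {q z : EuclideanSpace ℝ (Fin n)}
    (hq : q ∉ medialAxis M) (hz : z ∈ M) (hqz : dist q z = Metric.infDist q M)
    {ε : ℝ} (hε : 0 < ε) :
    ∀ᶠ q' in 𝓝 q, ∀ z' ∈ M, dist q' z' = Metric.infDist q' M → dist z' z < ε := by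
  by_contra hcon
  have hfreq : ∃ᶠ q' in 𝓝 q, ∃ z' ∈ M, dist q' z' = Metric.infDist q' M ∧ ε ≤ dist z' z :=
    (not_eventually.1 hcon).mono fun q' h => by
      push Not at h
      exact h
  obtain ⟨u, hu, hP⟩ := exists_seq_forall_of_frequently hfreq
  choose w hwM hwd hwε using hP
  have hinf : Tendsto (fun k => Metric.infDist (u k) M) atTop (𝓝 (Metric.infDist q M)) :=
    ((Metric.continuous_infDist_pt M).tendsto q).comp hu
  have hdq : Tendsto (fun k => dist (u k) q) atTop (𝓝 0) := by
    simpa using hu.dist (tendsto_const_nhds (x := q))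
  have hbd : ∀ᶠ k in atTop, w k ∈ Metric.closedBall q (Metric.infDist q M + 2) := by
    filter_upwards [hinf.eventually_lt_const (lt_add_one _), hdq.eventually_lt_const one_pos]
      with k h1 h2
    rw [Metric.mem_closedBall]
    have := dist_triangle (w k) (u k) q
    rw [dist_comm (w k) (u k), hwd k] at this
    linarith
  obtain ⟨y, -, φ, hφ, hy⟩ :=
    (isCompact_closedBall q (Metric.infDist q M + 2)).isSeqCompact.subseq_of_frequently_in
      hbd.frequently
  have hyM : y ∈ M := hM.mem_of_tendsto hy (Eventually.of_forall fun k => hwM _)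
  have hyd : dist q y = Metric.infDist q M := by
    refine tendsto_nhds_unique ((hu.comp hφ.tendsto_atTop).dist hy) ?_
    refine (hinf.comp hφ.tendsto_atTop).congr fun k => ?_
    exact (hwd _).symm
  have hyε : ε ≤ dist y z :=
    ge_of_tendsto (hy.dist tendsto_const_nhds) (Eventually.of_forall fun k => hwε _)
  have hyz : y ≠ z := by
    rintro rfl
    rw [dist_self] at hyε
    linarith
  exact hq ⟨y, hyM, z, hz, hyz, hyd, hqz⟩

/-- Away from `M` and its medial axis, the distance to `M` grows at unit speed in the direction that
points away from the nearest point. -/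
lemma infDist_ascent (hM : IsClosed M) {q z : EuclideanSpace ℝ (Fin n)}
    (hq : q ∉ medialAxis M) (hz : z ∈ M) (hqz : dist q z = Metric.infDist q M)
    (hpos : 0 < Metric.infDist q M) {η : ℝ} (hη0 : 0 ≤ η) (hη1 : η < 1) :
    ∀ᶠ s : ℝ in 𝓝[>] 0, Metric.infDist q M + η * s ≤
      Metric.infDist (q + s • ((Metric.infDist q M)⁻¹ • (q - z))) M := by
  set d := Metric.infDist q M with hd
  set u := d⁻¹ • (q - z) with hu
  have hun : ‖u‖ = 1 := by
    rw [hu, norm_smul, ← dist_eq_norm, hqz, norm_inv, Real.norm_of_nonneg hpos.le,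
      inv_mul_cancel₀ hpos.ne']
  have huq : inner ℝ u (q - z) = d := by
    rw [hu, inner_smul_left, real_inner_self_eq_norm_sq, ← dist_eq_norm, hqz]
    simp only [conj_trivial]
    field_simp
  have hc : Tendsto (fun s : ℝ => q + s • u) (𝓝[>] 0) (𝓝 q) := by
    have : Continuous fun s : ℝ => q + s • u := by fun_prop
    have h := this.tendsto 0
    simp only [zero_smul, add_zero] at h
    exact h.mono_left nhdsWithin_le_nhds
  -- A nearest point `w` this close to `z` keeps `⟪u, q - w⟫ ≥ η d`, so the squared distance is at
  -- least `d² + 2sηd + s² ≥ (d + ηs)²`.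
  have hε : 0 < (1 - η) * d := mul_pos (by linarith) hpos
  filter_upwards [hc.eventually (tendsto_nearest hM hq hz hqz hε), self_mem_nhdsWithin] with s h hs
  have hs : 0 < s := hs
  obtain ⟨w, hwM, hw⟩ := hM.exists_infDist_eq_dist ⟨z, hz⟩ (q + s • u)
  have hwz := h w hwM hw.symm
  rw [hw]
  have h1 : d ≤ ‖q - w‖ := by
    rw [← dist_eq_norm]; exact Metric.infDist_le_dist_of_mem hwM
  have h2 : d - (1 - η) * d ≤ inner ℝ u (q - w) := by
    have h3 : q - w = (q - z) - (w - z) := by abel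
    have h4 := real_inner_le_norm u (w - z)
    rw [hun, one_mul, ← dist_eq_norm] at h4
    rw [h3, inner_sub_right, huq]
    linarith
  have h5 : dist (q + s • u) w ^ 2 = ‖q - w‖ ^ 2 + 2 * (s * inner ℝ u (q - w)) + s ^ 2 := by
    rw [dist_eq_norm, show q + s • u - w = (q - w) + s • u by abel, norm_add_sq_real,
      inner_smul_right, real_inner_comm, norm_smul, hun, Real.norm_of_nonneg hs.le]
    ring
  refine le_of_sq_le_sq ?_ dist_nonneg
  rw [h5]
  have h6 := mul_le_mul_of_nonneg_left h2 hs.le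
  have h7 : d ^ 2 ≤ ‖q - w‖ ^ 2 := by gcongr
  have h8 : η ^ 2 * s ^ 2 ≤ s ^ 2 :=
    mul_le_of_le_one_left (sq_nonneg s) (pow_le_one₀ hη0 hη1.le)
  nlinarith

/-- A ray that starts as a shortest connection to `M` remains one up to the reach. -/
lemma infDist_ray (hM : IsClosed M) (hmed : ∀ q ∈ medialAxis M, τ ≤ Metric.infDist q M)
    {a v : EuclideanSpace ℝ (Fin n)} (ha : a ∈ M) (hv : ‖v‖ = 1) {r t : ℝ} (hr : 0 < r)
    (hrt : r ≤ t) (ht : t < τ) (har : Metric.infDist (a + r • v) M = r) :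
    Metric.infDist (a + t • v) M = t := by
  obtain ⟨ε, rfl⟩ : ∃ ε, t = r + ε := ⟨t - r, by ring⟩
  have hε : 0 ≤ ε := by linarith
  set p := a + r • v with hp
  have hcomp := isCompact_closedBall p ε
  have hnon : (Metric.closedBall p ε).Nonempty := ⟨p, Metric.mem_closedBall_self hε⟩
  -- This replaces the gradient flow of the distance: a maximizer of `infDist q M - η * dist q p`
  -- inside the open ball could be improved by moving at the larger rate `(1 + η) / 2`, so it lies
  -- on the sphere.
  have hstep : ∀ η : ℝ, 0 ≤ η → η < 1 →
      ∃ q ∈ Metric.closedBall p ε, r + η * ε ≤ Metric.infDist q M := by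
    intro η h0 h1
    obtain ⟨q, hqb, hqmax⟩ := hcomp.exists_isMaxOn hnon
      (f := fun q => Metric.infDist q M - η * dist q p)
      ((Metric.continuous_infDist_pt M).sub
        (continuous_const.mul (continuous_id.dist continuous_const))).continuousOn
    have hmax : ∀ y ∈ Metric.closedBall p ε,
        Metric.infDist y M - η * dist y p ≤ Metric.infDist q M - η * dist q p := hqmax
    have hqp := hmax p (Metric.mem_closedBall_self hε)
    rw [dist_self, har, mul_zero, sub_zero] at hqp
    have hηq : 0 ≤ η * dist q p := mul_nonneg h0 dist_nonneg
    refine ⟨q, hqb, ?_⟩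
    have hqle : dist q p ≤ ε := hqb
    rcases hqle.lt_or_eq with hlt | heq
    swap
    · rw [heq] at hqp; linarith
    exfalso
    have hdpos : 0 < Metric.infDist q M := by linarith
    have hdlt : Metric.infDist q M < τ := by
      have := Metric.infDist_le_infDist_add_dist (s := M) (x := q) (y := p)
      rw [har] at this
      linarith
    have hqmed : q ∉ medialAxis M := fun h => absurd (hmed q h) (by linarith)
    obtain ⟨z, hzM, hz⟩ := hM.exists_infDist_eq_dist ⟨a, ha⟩ q
    set u := (Metric.infDist q M)⁻¹ • (q - z) with hu
    have hun : ‖u‖ = 1 := by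
      rw [hu, norm_smul, ← dist_eq_norm, ← hz, norm_inv, Real.norm_of_nonneg hdpos.le,
        inv_mul_cancel₀ hdpos.ne']
    have hasc := infDist_ascent hM hqmed hzM hz.symm hdpos (η := (1 + η) / 2) (by linarith)
      (by linarith)
    have hsm : ∀ᶠ s : ℝ in 𝓝[>] 0, s < ε - dist q p :=
      nhdsWithin_le_nhds (Iio_mem_nhds (by linarith))
    obtain ⟨s, ⟨hs1, hs2⟩, hs0⟩ := ((hasc.and hsm).and self_mem_nhdsWithin).exists
    have hs0 : 0 < s := hs0
    have hd : dist (q + s • u) p ≤ dist q p + s := by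
      have := dist_triangle (q + s • u) q p
      rw [dist_self_add_left, norm_smul, hun, Real.norm_of_nonneg hs0.le] at this
      linarith
    have := hmax (q + s • u) (by rw [Metric.mem_closedBall]; linarith)
    have h3 := mul_le_mul_of_nonneg_left hd h0
    nlinarith
  obtain ⟨q, hqb, hqmax⟩ := hcomp.exists_isMaxOn hnon
    (Metric.continuous_infDist_pt M).continuousOn
  have hqd : r + ε ≤ Metric.infDist q M := by
    have hlim : Tendsto (fun η : ℝ => r + η * ε) (𝓝[<] 1) (𝓝 (r + 1 * ε)) := by
      have : Continuous fun η : ℝ => r + η * ε := by fun_prop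
      exact (this.tendsto 1).mono_left nhdsWithin_le_nhds
    rw [one_mul] at hlim
    have h01 : ∀ᶠ η : ℝ in 𝓝[<] 1, 0 ≤ η := nhdsWithin_le_nhds (Ici_mem_nhds one_pos)
    refine le_of_tendsto hlim ?_
    filter_upwards [h01, self_mem_nhdsWithin] with η h0 h1
    obtain ⟨q', hq', h⟩ := hstep η h0 h1
    exact h.trans (hqmax hq')
  -- Since `‖q - p‖ ≤ ε` and `‖p - a‖ = r`, this is equality in the triangle inequality, which puts
  -- `q` on the ray.
  have hqa : r + ε ≤ ‖(q - p) + r • v‖ := by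
    rw [show (q - p) + r • v = q - a by rw [hp]; abel, ← dist_eq_norm]
    exact hqd.trans (Metric.infDist_le_dist_of_mem ha)
  have hw : ‖q - p‖ ≤ ε := by rw [← dist_eq_norm]; exact hqb
  have hsq : ‖(q - p) + r • v‖ ^ 2 = ‖q - p‖ ^ 2 + 2 * (r * inner ℝ (q - p) v) + r ^ 2 := by
    rw [norm_add_sq_real, inner_smul_right, norm_smul, hv, Real.norm_of_nonneg hr.le]
    ring
  have hsq1 : (r + ε) ^ 2 ≤ ‖(q - p) + r • v‖ ^ 2 := by gcongr
  have hsq2 : ‖q - p‖ ^ 2 ≤ ε ^ 2 := by gcongr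
  have hin : ε ≤ inner ℝ (q - p) v := by
    by_contra hlt
    push Not at hlt
    have := mul_lt_mul_of_pos_left hlt hr
    nlinarith
  have hzero : ‖(q - p) - ε • v‖ ^ 2 ≤ 0 := by
    rw [norm_sub_sq_real, inner_smul_right, norm_smul, hv, Real.norm_of_nonneg hε]
    nlinarith
  have hqeq : q = a + (r + ε) • v := by
    have h0 : (q - p) - ε • v = 0 := by
      have := pow_eq_zero_iff (two_ne_zero) |>.1 (le_antisymm hzero (sq_nonneg _))
      exact norm_eq_zero.1 this
    rw [sub_sub, sub_eq_zero] at h0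
    rw [h0, hp, add_smul]
    abel
  rw [hqeq] at hqd
  refine le_antisymm ?_ hqd
  refine (Metric.infDist_le_dist_of_mem ha).trans ?_
  rw [dist_self_add_left, norm_smul, hv, Real.norm_of_nonneg (by linarith)]
  linarith

/-- The tangent ball of radius `τ` in the direction of a shortest connection misses `M`. -/
lemma inner_sub_nearest_le (hM : IsClosed M) (hmed : ∀ q ∈ medialAxis M, τ ≤ Metric.infDist q M)
    {q a z : EuclideanSpace ℝ (Fin n)} (hq : Metric.infDist q M < τ) (ha : a ∈ M)
    (hqa : dist q a = Metric.infDist q M) (hz : z ∈ M) :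
    2 * τ * inner ℝ (q - a) (z - a) ≤ ‖q - a‖ * ‖z - a‖ ^ 2 := by
  by_cases hqa0 : q = a
  · simp [hqa0]
  have hr : 0 < ‖q - a‖ := norm_pos_iff.2 (sub_ne_zero.2 hqa0)
  set r := ‖q - a‖ with hrdef
  have hrq : Metric.infDist q M = r := by rw [← hqa, dist_eq_norm]
  rw [hrq] at hq
  set v := r⁻¹ • (q - a) with hv
  have hvn : ‖v‖ = 1 := by
    rw [hv, norm_smul, norm_inv, norm_norm, inv_mul_cancel₀ hr.ne']
  have hqv : q - a = r • v := by rw [hv, smul_inv_smul₀ hr.ne']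
  have hq' : a + r • v = q := by rw [← hqv]; abel
  -- For `t < τ` the open ball of radius `t` about `a + t • v` misses `M`; the claim is the limit `t
  -- → τ`.
  have key : ∀ᶠ t in 𝓝[<] τ, 2 * t * inner ℝ v (z - a) ≤ ‖z - a‖ ^ 2 := by
    have hrt : ∀ᶠ t in 𝓝[<] τ, r ≤ t := nhdsWithin_le_nhds (Ici_mem_nhds hq)
    filter_upwards [hrt, self_mem_nhdsWithin] with t h1 h2
    have h3 := infDist_ray hM hmed ha hvn hr h1 h2 (by rw [hq', hrq])
    have h4 : t ≤ ‖(z - a) - t • v‖ := by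
      rw [← norm_neg, show -((z - a) - t • v) = a + t • v - z by abel, ← dist_eq_norm]
      exact h3.symm.le.trans (Metric.infDist_le_dist_of_mem hz)
    have h5 : t ^ 2 ≤ ‖(z - a) - t • v‖ ^ 2 := pow_le_pow_left₀ (by linarith) h4 2
    rw [norm_sub_sq_real, inner_smul_right, norm_smul, hvn, Real.norm_of_nonneg (by linarith),
      real_inner_comm] at h5
    linarith
  have hlim : Tendsto (fun t => 2 * t * inner ℝ v (z - a)) (𝓝[<] τ)
      (𝓝 (2 * τ * inner ℝ v (z - a))) := by
    have : Continuous fun t : ℝ => 2 * t * inner ℝ v (z - a) := by fun_prop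
    exact (this.tendsto τ).mono_left nhdsWithin_le_nhds
  have h := mul_le_mul_of_nonneg_left (le_of_tendsto hlim key) hr.le
  rw [hqv, inner_smul_left]
  simp only [conj_trivial]
  linarith

end Reach

/-! ### Tangent spaces in straightening charts -/

section Charts

variable {n m : ℕ} {M : Set (EuclideanSpace ℝ (Fin n))}

section Chart

variable {L : Submodule ℝ (EuclideanSpace ℝ (Fin n))}
  {e : OpenPartialHomeomorph (EuclideanSpace ℝ (Fin n)) (EuclideanSpace ℝ (Fin n))}
  {x : EuclideanSpace ℝ (Fin n)}

lemma chart_hasStrictFDerivAt (hx : x ∈ e.source) (he : ContDiffOn ℝ 1 e e.source) :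
    HasStrictFDerivAt e (fderiv ℝ e x) x :=
  (he.contDiffAt (e.open_source.mem_nhds hx)).hasStrictFDerivAt one_ne_zero

lemma chart_symm_hasStrictFDerivAt (hx : x ∈ e.source) (he' : ContDiffOn ℝ 1 e.symm e.target) :
    HasStrictFDerivAt e.symm (fderiv ℝ e.symm (e x)) (e x) :=
  (he'.contDiffAt (e.open_target.mem_nhds (e.map_source hx))).hasStrictFDerivAt one_ne_zero

lemma fderiv_symm_fderiv (hx : x ∈ e.source) (he : ContDiffOn ℝ 1 e e.source)
    (he' : ContDiffOn ℝ 1 e.symm e.target) (v : EuclideanSpace ℝ (Fin n)) :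
    fderiv ℝ e.symm (e x) (fderiv ℝ e x v) = v := by
  have h1 := (chart_symm_hasStrictFDerivAt hx he').hasFDerivAt.comp x
    (chart_hasStrictFDerivAt hx he).hasFDerivAt
  have h2 : HasFDerivAt (e.symm ∘ e) (ContinuousLinearMap.id ℝ _) x :=
    (hasFDerivAt_id x).congr_of_eventuallyEq (e.eventually_left_inverse hx)
  exact DFunLike.congr_fun (h1.unique h2) v

/-- In a straightening chart the tangent space is the preimage of the model subspace. -/
lemma tangentDirections_eq_comap (hxM : x ∈ M) (hx : x ∈ e.source)
    (he : ContDiffOn ℝ 1 e e.source) (he' : ContDiffOn ℝ 1 e.symm e.target)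
    (heM : ∀ y ∈ e.source, y ∈ M ↔ e y ∈ L) :
    tangentDirections M x = L.comap (fderiv ℝ e x : _ →ₗ[ℝ] EuclideanSpace ℝ (Fin n)) := by
  have hexL : e x ∈ L := (heM x hx).1 hxM
  apply le_antisymm
  · refine Submodule.span_le.2 ?_
    rintro v ⟨γ, h0, hγ, hv⟩
    subst h0
    have h1 : HasDerivAt (e ∘ γ) (fderiv ℝ e (γ 0) v) 0 :=
      (chart_hasStrictFDerivAt hx he).hasFDerivAt.comp_hasDerivAt 0 hv
    have h2 := h1.tendsto_slope
    have hs : ∀ᶠ t in 𝓝[≠] (0 : ℝ), slope (e ∘ γ) 0 t ∈ (L : Set (EuclideanSpace ℝ (Fin n))) := by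
      have hsrc := hv.continuousAt.eventually (e.open_source.mem_nhds hx)
      filter_upwards [nhdsWithin_le_nhds hγ, nhdsWithin_le_nhds hsrc] with t ht1 ht2
      rw [slope_def_module]
      exact L.smul_mem _ (L.sub_mem ((heM _ ht2).1 ht1) hexL)
    exact L.closed_of_finiteDimensional.mem_of_tendsto h2 hs
  · intro v hv
    have hv : fderiv ℝ e x v ∈ L := hv
    refine Submodule.subset_span ⟨fun s => e.symm (e x + s • fderiv ℝ e x v), ?_, ?_, ?_⟩
    · simp [e.left_inv hx]
    · have hc : ContinuousAt (fun s : ℝ => e x + s • fderiv ℝ e x v) 0 := by fun_prop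
      have ht : e.target ∈ 𝓝 (e x + (0 : ℝ) • fderiv ℝ e x v) := by
        simpa using e.open_target.mem_nhds (e.map_source hx)
      filter_upwards [hc.eventually ht] with s hs
      have hs : e x + s • fderiv ℝ e x v ∈ e.target := hs
      rw [heM _ (e.map_target hs), e.right_inv hs]
      exact L.add_mem hexL (L.smul_mem _ hv)
    · have h1 : HasDerivAt (fun s : ℝ => e x + s • fderiv ℝ e x v) (fderiv ℝ e x v) 0 := by
        simpa using ((hasDerivAt_id (0 : ℝ)).smul_const (fderiv ℝ e x v)).const_add (e x)
      have h2 : HasFDerivAt e.symm (fderiv ℝ e.symm (e x)) (e x + (0 : ℝ) • fderiv ℝ e x v) := by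
        simpa using (chart_symm_hasStrictFDerivAt hx he').hasFDerivAt
      have h3 := h2.comp_hasDerivAt (0 : ℝ) h1
      rwa [fderiv_symm_fderiv hx he he'] at h3

end Chart

/-- The tangent bundle of a closed submanifold is closed. -/
lemma isClosed_tangentBundle (hMc : IsClosed M) (hM : IsC1Submanifold m M) :
    IsClosed {p : EuclideanSpace ℝ (Fin n) × EuclideanSpace ℝ (Fin n) |
      p.1 ∈ M ∧ p.2 ∈ tangentDirections M p.1} := by
  refine isClosed_of_closure_subset fun p hp => ?_
  obtain ⟨u, hu, hlim⟩ := mem_closure_iff_seq_limit.1 hp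
  have h1 : Tendsto (fun k => (u k).1) atTop (𝓝 p.1) := hlim.fst_nhds
  have h2 : Tendsto (fun k => (u k).2) atTop (𝓝 p.2) := hlim.snd_nhds
  have hpM : p.1 ∈ M := hMc.mem_of_tendsto h1 (Eventually.of_forall fun k => (hu k).1)
  refine ⟨hpM, ?_⟩
  -- One chart presents all nearby tangent spaces as preimages of the same `L` under a continuously
  -- varying derivative.
  obtain ⟨L, e, -, hx, he, he', heM⟩ := hM p.1 hpM
  rw [tangentDirections_eq_comap hpM hx he he' heM]
  have hcont : ContinuousAt (fderiv ℝ e) p.1 :=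
    (he.continuousOn_fderiv_of_isOpen e.open_source le_rfl).continuousAt
      (e.open_source.mem_nhds hx)
  have h0 : Tendsto (fun k => fderiv ℝ e (u k).1) atTop (𝓝 (fderiv ℝ e p.1)) :=
    hcont.tendsto.comp h1
  have h3 : Tendsto (fun k => fderiv ℝ e (u k).1 (u k).2) atTop (𝓝 (fderiv ℝ e p.1 p.2)) :=
    (isBoundedBilinearMap_apply.continuous.tendsto (fderiv ℝ e p.1, p.2)).comp
      (h0.prodMk_nhds h2)
  refine L.closed_of_finiteDimensional.mem_of_tendsto h3 ?_
  filter_upwards [h1.eventually (e.open_source.mem_nhds hx)] with k hk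
  have := (hu k).2
  rw [tangentDirections_eq_comap (hu k).1 hk he he' heM] at this
  exact this

/-- A submanifold is tangent to its tangent space to first order. -/
lemma normalDirections_isLittleO (hM : IsC1Submanifold m M) {x : EuclideanSpace ℝ (Fin n)}
    (hxM : x ∈ M) {ε : ℝ} (hε : 0 < ε) :
    ∀ᶠ y in 𝓝 x, y ∈ M → ∀ w ∈ normalDirections M x,
      |inner ℝ w (y - x)| ≤ ε * ‖w‖ * ‖y - x‖ := by
  obtain ⟨L, e, -, hx, he, he', heM⟩ := hM x hxM
  have hD := (chart_hasStrictFDerivAt hx he).hasFDerivAt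
  have hO := hD.isBigO_sub
  have ho := (chart_symm_hasStrictFDerivAt hx he').hasFDerivAt.isLittleO
  have ho' := (ho.comp_tendsto hD.continuousAt.tendsto).trans_isBigO hO
  filter_upwards [ho'.def hε, e.eventually_left_inverse hx, e.open_source.mem_nhds hx]
    with y hy hinv hys hyM w hw
  simp only [Function.comp, hinv, e.left_inv hx] at hy
  -- The linear part of the expansion of `y - x` is tangent, so a normal `w` sees only the
  -- remainder.
  have hT : fderiv ℝ e.symm (e x) (e y - e x) ∈ tangentDirections M x := by
    rw [tangentDirections_eq_comap hxM hx he he' heM]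
    have h1 := (chart_symm_hasStrictFDerivAt hx he').hasFDerivAt
    have h2 : HasFDerivAt e (fderiv ℝ e x) (e.symm (e x)) := by rwa [e.left_inv hx]
    have h3 := h2.comp _ h1
    have h4 : HasFDerivAt (e ∘ e.symm) (ContinuousLinearMap.id ℝ _) (e x) :=
      (hasFDerivAt_id _).congr_of_eventuallyEq
        (e.eventually_right_inverse (e.map_source hx))
    have h5 := DFunLike.congr_fun (h3.unique h4) (e y - e x)
    change fderiv ℝ e x (fderiv ℝ e.symm (e x) (e y - e x)) ∈ L
    have h6 : fderiv ℝ e x (fderiv ℝ e.symm (e x) (e y - e x)) = e y - e x := h5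
    rw [h6]
    exact L.sub_mem ((heM y hys).1 hyM) ((heM x hx).1 hxM)
  have h0 : inner ℝ w (fderiv ℝ e.symm (e x) (e y - e x)) = 0 :=
    Submodule.inner_left_of_mem_orthogonal hT hw
  have h7 : inner ℝ w (y - x) = inner ℝ w (y - x - fderiv ℝ e.symm (e x) (e y - e x)) := by
    rw [inner_sub_right _ (y - x), h0, sub_zero]
  rw [h7]
  calc _ ≤ ‖w‖ * ‖y - x - fderiv ℝ e.symm (e x) (e y - e x)‖ := abs_real_inner_le_norm _ _
    _ ≤ ‖w‖ * (ε * ‖y - x‖) := by gcongr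
    _ = _ := by ring

/-- Near each of its points, a submanifold projects onto a neighbourhood in the tangent space. -/
lemma exists_mem_starProjection_eq (hM : IsC1Submanifold m M) {x : EuclideanSpace ℝ (Fin n)}
    (hxM : x ∈ M) {a : EuclideanSpace ℝ (Fin n)} (ha : a ∈ tangentDirections M x)
    {ρ : ℝ} (hρ : 0 < ρ) :
    ∀ᶠ s : ℝ in 𝓝 0, ∃ y ∈ M, ‖y - x‖ < ρ ∧
      (tangentDirections M x).starProjection (y - x) = s • a := by
  obtain ⟨L, e, -, hx, he, he', heM⟩ := hM x hxM
  set T := tangentDirections M x with hT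
  let F : L → T := fun u => T.orthogonalProjectionOnto (e.symm (e x + u) - x)
  have hin : HasStrictFDerivAt (fun u : L => e x + (u : EuclideanSpace ℝ (Fin n))) L.subtypeL 0 :=
    L.subtypeL.hasStrictFDerivAt.const_add (e x)
  have hsym : HasStrictFDerivAt e.symm (fderiv ℝ e.symm (e x))
      (e x + ((0 : L) : EuclideanSpace ℝ (Fin n))) := by
    simpa using chart_symm_hasStrictFDerivAt hx he'
  have hcomp := (hsym.comp (0 : L) hin).sub_const x
  have hF : HasStrictFDerivAt F
      (T.orthogonalProjectionOnto.comp ((fderiv ℝ e.symm (e x)).comp L.subtypeL)) 0 :=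
    T.orthogonalProjectionOnto.hasStrictFDerivAt.comp (0 : L) hcomp
  -- A surjective strict derivative makes `F` open at `0`, so small tangent vectors are attained.
  have hsurj : (T.orthogonalProjectionOnto.comp
      ((fderiv ℝ e.symm (e x)).comp L.subtypeL)).range = ⊤ := by
    rw [LinearMap.range_eq_top]
    intro t
    have htT : (t : EuclideanSpace ℝ (Fin n)) ∈ L.comap (fderiv ℝ e x : _ →ₗ[ℝ] _) := by
      rw [← tangentDirections_eq_comap hxM hx he he' heM]
      exact t.2
    refine ⟨⟨fderiv ℝ e x t, htT⟩, ?_⟩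
    change T.orthogonalProjectionOnto (fderiv ℝ e.symm (e x) (fderiv ℝ e x t)) = t
    rw [fderiv_symm_fderiv hx he he']
    exact Submodule.orthogonalProjectionOnto_mem_subspace_eq_self t
  have hmap := hF.map_nhds_eq_of_surj hsurj
  have hF0 : F 0 = 0 := by simp [F, e.left_inv hx]
  rw [hF0] at hmap
  have hgood : ∀ᶠ u : L in 𝓝 0, e x + (u : EuclideanSpace ℝ (Fin n)) ∈ e.target ∧
      ‖e.symm (e x + u) - x‖ < ρ := by
    have h1 : ContinuousAt (fun u : L => e x + (u : EuclideanSpace ℝ (Fin n))) 0 :=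
      hin.continuousAt
    refine (h1.eventually (e.open_target.mem_nhds ?_)).and ?_
    · simpa using e.map_source hx
    · have h2 := hcomp.continuousAt.norm
      refine h2.eventually_lt_const ?_
      simpa [e.left_inv hx] using hρ
  have himg : F '' {u : L | e x + (u : EuclideanSpace ℝ (Fin n)) ∈ e.target ∧
      ‖e.symm (e x + u) - x‖ < ρ} ∈ 𝓝 (0 : T) := by
    rw [← hmap]
    exact image_mem_map hgood
  have hc : Tendsto (fun s : ℝ => s • (⟨a, ha⟩ : T)) (𝓝 0) (𝓝 0) := by
    have : Continuous fun s : ℝ => s • (⟨a, ha⟩ : T) := by fun_prop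
    simpa using this.tendsto 0
  filter_upwards [hc.eventually himg] with s hs
  obtain ⟨u, ⟨hu1, hu2⟩, hu3⟩ := hs
  refine ⟨e.symm (e x + u), ?_, hu2, ?_⟩
  · rw [heM _ (e.map_target hu1), e.right_inv hu1]
    exact L.add_mem ((heM x hx).1 hxM) u.2
  · exact congrArg Subtype.val hu3

end Charts

/-! ### Federer's bound for arbitrary normal vectors -/

section Normals

variable {n m : ℕ} {M : Set (EuclideanSpace ℝ (Fin n))} {τ : ℝ}

/-- The open balls of radius `τ` that are tangent to a submanifold of reach `τ` miss it. -/
lemma inner_normal_le (hMc : IsClosed M) (hM : IsC1Submanifold m M)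
    (hmed : ∀ q ∈ medialAxis M, τ ≤ Metric.infDist q M) (hτ : 0 < τ)
    {x z w : EuclideanSpace ℝ (Fin n)} (hx : x ∈ M) (hw : w ∈ normalDirections M x)
    (hz : z ∈ M) : 2 * τ * inner ℝ w (z - x) ≤ ‖w‖ * ‖z - x‖ ^ 2 := by
  -- It is not known that `x` is nearest to `x + t • w`. The bound is applied at a true nearest
  -- point `a t`, and passes to the limit because `‖a t - x‖ = o(t)`.
  choose a haM ha using fun t : ℝ => hMc.exists_infDist_eq_dist ⟨x, hx⟩ (x + t • w)
  have hle : ∀ t : ℝ, 0 ≤ t → ‖t • w - (a t - x)‖ ≤ t * ‖w‖ := fun t ht => by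
    have := Metric.infDist_le_dist_of_mem (x := x + t • w) hx
    rw [ha, dist_self_add_left, norm_smul, Real.norm_of_nonneg ht, dist_eq_norm] at this
    rwa [show t • w - (a t - x) = x + t • w - a t by abel]
  have hle2 : ∀ t : ℝ, 0 ≤ t → ‖a t - x‖ ≤ 2 * t * ‖w‖ := fun t ht => by
    have h1 := norm_sub_le (t • w) (t • w - (a t - x))
    rw [sub_sub_cancel, norm_smul, Real.norm_of_nonneg ht] at h1
    linarith [hle t ht]
  have hpos : ∀ᶠ t : ℝ in 𝓝[>] 0, 0 < t := self_mem_nhdsWithin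
  have hlin : ∀ c : ℝ, Tendsto (fun t : ℝ => t * c) (𝓝[>] 0) (𝓝 0) := fun c => by
    have : Continuous fun t : ℝ => t * c := by fun_prop
    simpa using (this.tendsto 0).mono_left nhdsWithin_le_nhds
  have hax : Tendsto a (𝓝[>] 0) (𝓝 x) := by
    rw [tendsto_iff_norm_sub_tendsto_zero]
    refine squeeze_zero' (Eventually.of_forall fun t => norm_nonneg _) ?_ (hlin (2 * ‖w‖))
    filter_upwards [hpos] with t ht
    linarith [hle2 t ht.le]
  set f : ℝ → EuclideanSpace ℝ (Fin n) := fun t => t⁻¹ • (x + t • w - a t) with hf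
  have hfw : Tendsto f (𝓝[>] 0) (𝓝 w) := by
    rw [Metric.tendsto_nhds]
    intro η hη
    have hε : 0 < η / (2 * (‖w‖ + 1)) := by positivity
    filter_upwards [hpos, hax.eventually (normalDirections_isLittleO hM hx hε)] with t ht h
    have h1 := (le_abs_self _).trans (h (haM t) w hw)
    have h2 : ‖t • w - (a t - x)‖ ^ 2 ≤ (t * ‖w‖) ^ 2 := by
      have := hle t ht.le
      gcongr
    rw [norm_sub_sq_real, inner_smul_left, norm_smul, Real.norm_of_nonneg ht.le] at h2
    simp only [conj_trivial] at h2
    -- `h2` gives `‖a t - x‖² ≤ 2t⟪w, a t - x⟫`, and first-order tangency makes the right side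
    -- small.
    have h3 : ‖a t - x‖ ≤ 2 * t * (η / (2 * (‖w‖ + 1)) * ‖w‖) := by
      by_contra hlt
      push Not at hlt
      have h0 : 0 < ‖a t - x‖ := lt_of_le_of_lt (by positivity) hlt
      have h4 := mul_lt_mul_of_pos_right hlt h0
      have h5 := mul_le_mul_of_nonneg_left h1 ht.le
      nlinarith
    have h6 : dist (f t) w = t⁻¹ * ‖a t - x‖ := by
      rw [dist_eq_norm, show f t - w = -(t⁻¹ • (a t - x)) by
        simp only [hf, smul_sub, smul_add, inv_smul_smul₀ ht.ne']
        abel, norm_neg, norm_smul, norm_inv, Real.norm_of_nonneg ht.le]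
    rw [h6]
    calc t⁻¹ * ‖a t - x‖ ≤ t⁻¹ * (2 * t * (η / (2 * (‖w‖ + 1)) * ‖w‖)) := by gcongr
      _ = η * (‖w‖ / (‖w‖ + 1)) := by field_simp
      _ < η * 1 := by
        gcongr
        rw [div_lt_one (by positivity)]
        linarith
      _ = η := mul_one η
  have hza : Tendsto (fun t => z - a t) (𝓝[>] 0) (𝓝 (z - x)) := hax.const_sub z
  refine le_of_tendsto_of_tendsto ((hfw.inner hza).const_mul (2 * τ))
    (hfw.norm.mul (hza.norm.pow 2)) ?_
  filter_upwards [hpos, (hlin ‖w‖).eventually_lt_const hτ] with t ht htw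
  have hd : Metric.infDist (x + t • w) M < τ := by
    refine lt_of_le_of_lt (Metric.infDist_le_dist_of_mem hx) ?_
    rwa [dist_self_add_left, norm_smul, Real.norm_of_nonneg ht.le]
  have h := inner_sub_nearest_le hMc hmed hd (haM t) (ha t).symm hz
  have h' := mul_le_mul_of_nonneg_left h (inv_nonneg.2 ht.le)
  simp only [hf, inner_smul_left, norm_smul, norm_inv, Real.norm_of_nonneg ht.le, conj_trivial]
  linarith

lemma abs_inner_normal_le (hMc : IsClosed M) (hM : IsC1Submanifold m M)
    (hmed : ∀ q ∈ medialAxis M, τ ≤ Metric.infDist q M) (hτ : 0 < τ)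
    {x z w : EuclideanSpace ℝ (Fin n)} (hx : x ∈ M) (hw : w ∈ normalDirections M x)
    (hz : z ∈ M) : 2 * τ * |inner ℝ w (z - x)| ≤ ‖w‖ * ‖z - x‖ ^ 2 := by
  rcases abs_choice (inner ℝ w (z - x) : ℝ) with h | h <;> rw [h]
  · exact inner_normal_le hMc hM hmed hτ hx hw hz
  · have := inner_normal_le hMc hM hmed hτ hx (neg_mem hw) hz
    rwa [inner_neg_left, norm_neg] at this

/-- Federer's estimate of the normal component of a chord. -/
lemma norm_normal_starProjection_le (hMc : IsClosed M) (hM : IsC1Submanifold m M)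
    (hmed : ∀ q ∈ medialAxis M, τ ≤ Metric.infDist q M) (hτ : 0 < τ)
    {x z : EuclideanSpace ℝ (Fin n)} (hx : x ∈ M) (hz : z ∈ M) :
    2 * τ * ‖(normalDirections M x).starProjection (z - x)‖ ≤ ‖z - x‖ ^ 2 := by
  set b := (normalDirections M x).starProjection (z - x) with hb
  have hbN : b ∈ normalDirections M x := Submodule.starProjection_apply_mem _ _
  have h := inner_normal_le hMc hM hmed hτ hx hbN hz
  have h1 : inner ℝ b (z - x) = ‖b‖ ^ 2 := by
    have := Submodule.starProjection_inner_eq_zero (K := normalDirections M x) (z - x) b hbN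
    rw [← hb, inner_sub_left, real_inner_self_eq_norm_sq, real_inner_comm] at this
    linarith
  rw [h1] at h
  rcases (norm_nonneg b).eq_or_lt with h0 | h0
  · rw [← h0]; simp
  · refine le_of_mul_le_mul_left ?_ h0
    linarith

lemma starProjection_tangent_add_normal (x v : EuclideanSpace ℝ (Fin n)) :
    (tangentDirections M x).starProjection v + (normalDirections M x).starProjection v = v :=
  Submodule.starProjection_add_starProjection_orthogonal v

lemma norm_sq_eq_tangent_add_normal (x v : EuclideanSpace ℝ (Fin n)) :
    ‖v‖ ^ 2 = ‖(tangentDirections M x).starProjection v‖ ^ 2 +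
      ‖(normalDirections M x).starProjection v‖ ^ 2 :=
  Submodule.norm_sq_eq_add_norm_sq_starProjection v _

end Normals

/-! ### Minimizing a weighted distance over `M` -/

section Tube

variable {n m : ℕ} {M : Set (EuclideanSpace ℝ (Fin n))} {τ : ℝ}

lemma norm_normal_starProjection_le_of_mem_tangent {x t : EuclideanSpace ℝ (Fin n)}
    (ht : t ∈ tangentDirections M x) (v : EuclideanSpace ℝ (Fin n)) :
    ‖(normalDirections M x).starProjection v‖ ≤ ‖v - t‖ := by
  have h : (normalDirections M x).starProjection (v - t) =
      (normalDirections M x).starProjection v := by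
    have h1 := starProjection_tangent_add_normal (M := M) x t
    rw [Submodule.starProjection_eq_self_iff.2 ht, add_eq_left] at h1
    rw [map_sub, h1, sub_zero]
  rw [← h]
  exact Submodule.norm_starProjection_apply_le _ _

lemma sub_tangent_starProjection (x v : EuclideanSpace ℝ (Fin n)) :
    v - (tangentDirections M x).starProjection v = (normalDirections M x).starProjection v := by
  rw [sub_eq_iff_eq_add']
  exact (starProjection_tangent_add_normal x v).symm

/-- The norm of the normal component is the minimum of `‖y - w - t‖` over tangent `t`. Minimizing
over pairs `(w, t)` in a compact piece of the closed tangent bundle thus avoids continuity of the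
projections. -/
lemma exists_min_weighted_dist (hMc : IsClosed M) (hM : IsC1Submanifold m M) (hne : M.Nonempty)
    (y : EuclideanSpace ℝ (Fin n)) {c d : ℝ} (hc : 1 ≤ c) (hd : 0 ≤ d) :
    ∃ z ∈ M, ∀ w ∈ M,
      c * ‖y - z‖ ^ 2 + d * ‖(normalDirections M z).starProjection (y - z)‖ ≤
        c * ‖y - w‖ ^ 2 + d * ‖(normalDirections M w).starProjection (y - w)‖ := by
  obtain ⟨x, hx⟩ := hne
  set g : EuclideanSpace ℝ (Fin n) → ℝ := fun w =>
    c * ‖y - w‖ ^ 2 + d * ‖(normalDirections M w).starProjection (y - w)‖ with hg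
  have hgle : ∀ w, ‖y - w‖ ^ 2 ≤ g w := fun w => by
    have h1 := mul_le_mul_of_nonneg_right hc (sq_nonneg ‖y - w‖)
    have h2 := mul_nonneg hd (norm_nonneg ((normalDirections M w).starProjection (y - w)))
    simp only [hg]
    linarith
  have hgx : 0 ≤ g x := (sq_nonneg _).trans (hgle x)
  set R := √(g x) with hR
  set K := {p : EuclideanSpace ℝ (Fin n) × EuclideanSpace ℝ (Fin n) |
      p.1 ∈ M ∧ p.2 ∈ tangentDirections M p.1} ∩
      (Metric.closedBall y R ×ˢ Metric.closedBall 0 R) with hK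
  have hKc : IsCompact K :=
    ((isCompact_closedBall y R).prod (isCompact_closedBall 0 R)).inter_left
      (isClosed_tangentBundle hMc hM)
  have hmemK : ∀ w ∈ M, ‖y - w‖ ≤ R →
      (w, (tangentDirections M w).starProjection (y - w)) ∈ K := fun w hw hwR => by
    refine ⟨⟨hw, Submodule.starProjection_apply_mem _ _⟩, ?_, ?_⟩
    · rwa [Metric.mem_closedBall, dist_comm, dist_eq_norm]
    · rw [mem_closedBall_zero_iff]
      exact (Submodule.norm_starProjection_apply_le _ _).trans hwR
  have hxR : ‖y - x‖ ≤ R := Real.le_sqrt_of_sq_le (hgle x)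
  have hcont : Continuous fun p : EuclideanSpace ℝ (Fin n) × EuclideanSpace ℝ (Fin n) =>
      c * ‖y - p.1‖ ^ 2 + d * ‖y - p.1 - p.2‖ := by fun_prop
  obtain ⟨⟨z, t⟩, hzK, hmin⟩ := hKc.exists_isMinOn ⟨_, hmemK x hx hxR⟩ hcont.continuousOn
  have hz : ∀ w ∈ M, ‖y - w‖ ≤ R → g z ≤ g w := fun w hw hwR => by
    have h1 := isMinOn_iff.1 hmin _ (hmemK w hw hwR)
    dsimp only at h1
    rw [sub_tangent_starProjection] at h1
    have h2 := norm_normal_starProjection_le_of_mem_tangent hzK.1.2 (y - z)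
    have h3 := mul_le_mul_of_nonneg_left h2 hd
    simp only [hg]
    linarith
  refine ⟨z, hzK.1.1, fun w hw => ?_⟩
  by_cases hwR : ‖y - w‖ ≤ R
  · exact hz w hw hwR
  · push Not at hwR
    refine (hz x hx hxR).trans (le_trans ?_ (hgle w))
    rw [← Real.sq_sqrt hgx]
    gcongr

/-- How the tangent and normal components of `y - x` change when `x` moves along `M`. -/
lemma normal_variation (hMc : IsClosed M) (hM : IsC1Submanifold m M)
    (hmed : ∀ q ∈ medialAxis M, τ ≤ Metric.infDist q M) (hτ : 0 < τ)
    {y z w : EuclideanSpace ℝ (Fin n)} (hz : z ∈ M) (hw : w ∈ M) {s : ℝ} (hs : 0 < s)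
    (hzw : (tangentDirections M z).starProjection (w - z) =
      s • (tangentDirections M z).starProjection (y - z)) :
    ‖y - w‖ ^ 2 ≤ ‖y - z‖ ^ 2 - 2 * s * ‖(tangentDirections M z).starProjection (y - z)‖ ^ 2 +
        ‖(normalDirections M z).starProjection (y - z)‖ * ‖w - z‖ ^ 2 / τ + ‖w - z‖ ^ 2 ∧
      ‖(normalDirections M w).starProjection (y - w)‖ ≤
        ‖(normalDirections M z).starProjection (y - z)‖ + ‖w - z‖ ^ 2 / (2 * τ) +
        ‖w - z‖ ^ 2 / (τ * s) := by
  set a := (tangentDirections M z).starProjection (y - z) with ha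
  set b := (normalDirections M z).starProjection (y - z) with hb
  set k := (normalDirections M z).starProjection (w - z) with hk
  set ρ := ‖w - z‖ with hρ
  have hab : a + b = y - z := starProjection_tangent_add_normal z (y - z)
  have hsk : s • a + k = w - z := by
    rw [← hzw]; exact starProjection_tangent_add_normal z (w - z)
  have haT : a ∈ tangentDirections M z := Submodule.starProjection_apply_mem _ _
  have hbN : b ∈ normalDirections M z := Submodule.starProjection_apply_mem _ _
  have hkρ : 2 * τ * ‖k‖ ≤ ρ ^ 2 := norm_normal_starProjection_le hMc hM hmed hτ hz hw
  have hak : inner ℝ a k = 0 :=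
    Submodule.inner_right_of_mem_orthogonal haT (Submodule.starProjection_apply_mem _ _)
  constructor
  · have h1 : ‖y - w‖ ^ 2 = ‖y - z‖ ^ 2 - 2 * inner ℝ (y - z) (w - z) + ρ ^ 2 := by
      rw [← norm_sub_sq_real, sub_sub_sub_cancel_right]
    have h2 : inner ℝ (y - z) (w - z) = s * ‖a‖ ^ 2 + inner ℝ b (w - z) := by
      rw [← hab, inner_add_left, ← hsk, inner_add_right, inner_smul_right,
        real_inner_self_eq_norm_sq, hak, add_zero]
    have h3 := abs_inner_normal_le hMc hM hmed hτ hz hbN hw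
    have h4 := neg_abs_le (inner ℝ b (w - z))
    have h5 : 2 * |inner ℝ b (w - z)| ≤ ‖b‖ * ρ ^ 2 / τ := by
      rw [le_div_iff₀ hτ]; linarith
    rw [h1, h2]
    linarith
  · set c := (normalDirections M w).starProjection (y - w) with hc
    have hcN : c ∈ normalDirections M w := Submodule.starProjection_apply_mem _ _
    rcases (norm_nonneg c).eq_or_lt with h0 | h0
    · rw [← h0]; positivity
    have h1 : ‖c‖ ^ 2 = inner ℝ c (y - w) := by
      have := Submodule.starProjection_inner_eq_zero (K := normalDirections M w) (y - w) c hcN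
      rw [← hc, inner_sub_left, real_inner_self_eq_norm_sq, real_inner_comm] at this
      linarith
    have h2 : inner ℝ c (y - w) = inner ℝ c a + inner ℝ c b - inner ℝ c (w - z) := by
      rw [← inner_add_right, hab, ← inner_sub_right, sub_sub_sub_cancel_right]
    have h3 := abs_inner_normal_le hMc hM hmed hτ hw hcN hz
    rw [← neg_sub w z, inner_neg_right, abs_neg, norm_neg, ← hρ] at h3
    -- Since `s • a = (w - z) - k`, Federer's bound at `w` controls the first term and at `z` the
    -- second.
    have h4 : s * inner ℝ c a = inner ℝ c (w - z) - inner ℝ c k := by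
      rw [← inner_sub_right, ← hsk, add_sub_cancel_right, inner_smul_right]
    have h5 := real_inner_le_norm c b
    have h6 := (abs_le.1 (abs_real_inner_le_norm c k)).1
    have h7 := mul_le_mul_of_nonneg_left hkρ h0.le
    have h8 := abs_le.1 (le_refl |inner ℝ c (w - z)|)
    have h9 : inner ℝ c a ≤ ‖c‖ * (ρ ^ 2 / (τ * s)) := by
      rw [mul_div_assoc', le_div_iff₀ (by positivity)]
      nlinarith [h8.2]
    have h10 : -inner ℝ c (w - z) ≤ ‖c‖ * (ρ ^ 2 / (2 * τ)) := by
      rw [mul_div_assoc', le_div_iff₀ (by positivity)]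
      nlinarith [h8.1]
    refine le_of_mul_le_mul_left ?_ h0
    nlinarith

/-- Moving `z` along `M` by about `s • a` lowers the squared distance by `2s‖a‖²` to first order and
raises `2τ` times the normal norm by at most the same amount. The extra weight `δ` tips the balance.
-/
lemma tangent_eq_zero_of_min (hMc : IsClosed M) (hM : IsC1Submanifold m M)
    (hmed : ∀ q ∈ medialAxis M, τ ≤ Metric.infDist q M) (hτ : 0 < τ)
    {y z : EuclideanSpace ℝ (Fin n)} (hz : z ∈ M) {δ : ℝ} (hδ : 0 < δ)
    (hmin : ∀ w ∈ M,
      (1 + δ) * ‖y - z‖ ^ 2 + 2 * τ * ‖(normalDirections M z).starProjection (y - z)‖ ≤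
      (1 + δ) * ‖y - w‖ ^ 2 + 2 * τ * ‖(normalDirections M w).starProjection (y - w)‖) :
    (tangentDirections M z).starProjection (y - z) = 0 := by
  set a := (tangentDirections M z).starProjection (y - z) with ha
  set b := (normalDirections M z).starProjection (y - z) with hb
  by_contra ha0
  have haT : a ∈ tangentDirections M z := Submodule.starProjection_apply_mem _ _
  have hA : 0 < ‖a‖ ^ 2 := pow_pos (norm_pos_iff.2 ha0) 2
  set K : ℝ := (1 + δ) * (‖b‖ / τ + 1) + 1 with hK
  have hKpos : 0 < K := by positivity
  -- With this radius, Federer's bound and Pythagoras give `‖w - z‖² ≤ (1 + δ/2) s²‖a‖²`.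
  have hρ0 : 0 < √(2 * τ ^ 2 * δ / (1 + δ / 2)) := Real.sqrt_pos.2 (by positivity)
  -- Makes `(1 + δ/2)(sK + 2) < 2(1 + δ)`, contradicting `h12`.
  have hs1 : ∀ᶠ s : ℝ in 𝓝[>] 0, s < δ / ((1 + δ / 2) * K) :=
    nhdsWithin_le_nhds (Iio_mem_nhds (by positivity))
  obtain ⟨s, ⟨⟨w, hw, hwρ, hws⟩, hsδ⟩, hs0⟩ :=
    (((exists_mem_starProjection_eq hM hz haT hρ0).filter_mono nhdsWithin_le_nhds |>.and
      hs1).and self_mem_nhdsWithin).exists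
  have hs : 0 < s := hs0
  obtain ⟨h1, h2⟩ := normal_variation hMc hM hmed hτ hz hw hs hws
  have h3 := hmin w hw
  have hkρ := norm_normal_starProjection_le hMc hM hmed hτ hz hw
  have hpy := norm_sq_eq_tangent_add_normal (M := M) z (w - z)
  rw [hws, norm_smul, Real.norm_of_nonneg hs.le, mul_pow] at hpy
  rw [← ha, ← hb] at h1
  rw [← hb] at h2
  set k := ‖(normalDirections M z).starProjection (w - z)‖ with hk
  have hk0 : 0 ≤ k := norm_nonneg _
  have hq : ‖w - z‖ ^ 2 < 2 * τ ^ 2 * δ / (1 + δ / 2) := by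
    rw [← Real.lt_sqrt (norm_nonneg _)]; exact hwρ
  set q := ‖w - z‖ ^ 2 with hqdef
  have hq0 : 0 ≤ q := sq_nonneg _
  rw [lt_div_iff₀ (by positivity)] at hq
  have hk2 : 4 * τ ^ 2 * k ^ 2 ≤ q ^ 2 := by
    have := pow_le_pow_left₀ (by positivity) hkρ 2
    nlinarith
  have hqle : q ≤ (1 + δ / 2) * (s ^ 2 * ‖a‖ ^ 2) := by
    have h4 : q * (q * (1 + δ / 2)) ≤ q * (2 * τ ^ 2 * δ) :=
      mul_le_mul_of_nonneg_left hq.le hq0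
    have h5 : 4 * τ ^ 2 * q ≤ 4 * τ ^ 2 * ((1 + δ / 2) * (s ^ 2 * ‖a‖ ^ 2)) := by
      have h6 : k ^ 2 = q - s ^ 2 * ‖a‖ ^ 2 := by linarith
      rw [h6] at hk2
      have h7 := mul_le_mul_of_nonneg_right hk2 (by positivity : 0 ≤ 1 + δ / 2)
      linarith
    exact le_of_mul_le_mul_left h5 (by positivity)
  have h8 : 0 ≤ (1 + δ) * (-(2 * s * ‖a‖ ^ 2) + ‖b‖ * q / τ + q) + q + 2 * (q / s) := by
    have h9 := mul_le_mul_of_nonneg_left h1 (by positivity : 0 ≤ 1 + δ)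
    have h10 := mul_le_mul_of_nonneg_left h2 (by positivity : 0 ≤ 2 * τ)
    have h11 : 2 * τ * (‖b‖ + q / (2 * τ) + q / (τ * s)) = 2 * τ * ‖b‖ + q + 2 * (q / s) := by
      field_simp
    linarith
  have h12 : 0 ≤ -2 * (1 + δ) * (s ^ 2 * ‖a‖ ^ 2) + q * (s * K + 2) := by
    have h13 := mul_nonneg h8 hs.le
    have h14 : ((1 + δ) * (-(2 * s * ‖a‖ ^ 2) + ‖b‖ * q / τ + q) + q + 2 * (q / s)) * s =
        -2 * (1 + δ) * (s ^ 2 * ‖a‖ ^ 2) + q * (s * K + 2) := by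
      rw [hK]
      field_simp
      ring
    linarith
  have h15 := mul_le_mul_of_nonneg_right hqle (by positivity : 0 ≤ s * K + 2)
  have h16 : s * ((1 + δ / 2) * K) < δ := by rwa [lt_div_iff₀ (by positivity)] at hsδ
  have h17 : 0 < s ^ 2 * ‖a‖ ^ 2 := by positivity
  nlinarith

/-- A point whose displacement from some point of `M` is small, with the normal component counted
more heavily, has distance less than `τ` from `M`. -/
lemma infDist_lt_of_normal_bound (hMc : IsClosed M) (hM : IsC1Submanifold m M)
    (hmed : ∀ q ∈ medialAxis M, τ ≤ Metric.infDist q M) (hτ : 0 < τ)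
    {x y : EuclideanSpace ℝ (Fin n)} (hx : x ∈ M)
    (h : ‖y - x‖ ^ 2 + 2 * τ * ‖(normalDirections M x).starProjection (y - x)‖ < 3 * τ ^ 2) :
    Metric.infDist y M < τ := by
  obtain ⟨δ, hδ, hδx⟩ : ∃ δ : ℝ, 0 < δ ∧ (1 + δ) * ‖y - x‖ ^ 2 +
      2 * τ * ‖(normalDirections M x).starProjection (y - x)‖ < 3 * τ ^ 2 := by
    have hc : Tendsto (fun δ : ℝ => (1 + δ) * ‖y - x‖ ^ 2 +
        2 * τ * ‖(normalDirections M x).starProjection (y - x)‖) (𝓝[>] 0)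
        (𝓝 ((1 + 0) * ‖y - x‖ ^ 2 +
          2 * τ * ‖(normalDirections M x).starProjection (y - x)‖)) := by
      have : Continuous fun δ : ℝ => (1 + δ) * ‖y - x‖ ^ 2 +
        2 * τ * ‖(normalDirections M x).starProjection (y - x)‖ := by fun_prop
      exact (this.tendsto 0).mono_left nhdsWithin_le_nhds
    rw [add_zero, one_mul] at hc
    obtain ⟨δ, h1, h2⟩ := ((hc.eventually_lt_const h).and self_mem_nhdsWithin).exists
    exact ⟨δ, h2, h1⟩
  obtain ⟨z, hz, hmin⟩ := exists_min_weighted_dist hMc hM ⟨x, hx⟩ y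
    (by linarith : 1 ≤ 1 + δ) (by positivity : 0 ≤ 2 * τ)
  have ha := tangent_eq_zero_of_min hMc hM hmed hτ hz hδ hmin
  have hb := starProjection_tangent_add_normal (M := M) z (y - z)
  rw [ha, zero_add] at hb
  have h1 := (hmin x hx).trans_lt hδx
  rw [hb] at h1
  refine (Metric.infDist_le_dist_of_mem hz).trans_lt ?_
  rw [dist_eq_norm]
  -- If `‖y - z‖ ≥ τ`, the left side of `h1` would be at least `τ² + 2τ²`.
  by_contra hlt
  push Not at hlt
  nlinarith [mul_nonneg hδ.le (sq_nonneg ‖y - z‖)]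

end Tube

/-! ### Ellipse inequalities and the persistence bound -/

section Ellipsoids

lemma sq_add_lt_of_ellipse {τ p t b : ℝ} (hp : 0 < p) (hpτ : p < τ)
    (h : t ^ 2 / (τ * p + p ^ 2) + b ^ 2 / p ^ 2 < 1) :
    t ^ 2 + b ^ 2 + 2 * τ * b < 3 * τ ^ 2 := by
  have hτ : 0 < τ := hp.trans hpτ
  have h1 : t ^ 2 * p + b ^ 2 * (τ + p) < p ^ 2 * (τ + p) := by
    have h2 : t ^ 2 / (τ * p + p ^ 2) + b ^ 2 / p ^ 2 =
        (t ^ 2 * p + b ^ 2 * (τ + p)) / (p ^ 2 * (τ + p)) := by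
      field_simp
    rwa [h2, div_lt_one (by positivity)] at h
  -- Absorbs `2τpb - τb² ≤ τp²`; the resulting bound `(p + τ)² - τ²` is below `3τ²` because `p < τ`.
  have h3 : 0 ≤ τ * (p - b) ^ 2 := by positivity
  have h4 : p * (t ^ 2 + b ^ 2 + 2 * τ * b) < p * ((p + τ) ^ 2 - τ ^ 2) := by nlinarith
  have h5 := lt_of_mul_lt_mul_left h4 hp.le
  nlinarith

lemma ellipse_of_sq_lt {τ p t b : ℝ} (hτ : 0 < τ) (hp : 0 < p) (hb : 0 ≤ b)
    (hbD : 2 * τ * b ≤ t ^ 2 + b ^ 2)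
    (hD : t ^ 2 + b ^ 2 < 2 * p * (√(τ * (p + 2 * τ)) - τ)) :
    t ^ 2 / (τ * p + p ^ 2) + b ^ 2 / p ^ 2 < 1 := by
  have h2 : t ^ 2 / (τ * p + p ^ 2) + b ^ 2 / p ^ 2 =
      (t ^ 2 * p + b ^ 2 * (τ + p)) / (p ^ 2 * (τ + p)) := by
    field_simp
  rw [h2, div_lt_one (by positivity)]
  set D := t ^ 2 + b ^ 2 with hDdef
  set r := √(τ * (p + 2 * τ)) with hr
  have hr2 : r ^ 2 = τ * (p + 2 * τ) := Real.sq_sqrt (by positivity)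
  have hD0 : 0 ≤ D := by positivity
  have h3 : (2 * τ * b) ^ 2 ≤ D ^ 2 := pow_le_pow_left₀ (by positivity) hbD 2
  -- Completed square of `D² + 4τpD < 4τp²(τ + p)`, which is the ellipse condition after `b` is
  -- replaced by `D / (2τ)`.
  have h4 : (D + 2 * p * τ) ^ 2 < (2 * p * r) ^ 2 :=
    pow_lt_pow_left₀ (by linarith) (by positivity) two_ne_zero
  rw [mul_pow (2 * p) r, hr2] at h4
  have h5 : 4 * τ * (D * p + b ^ 2 * τ) < 4 * τ * (p ^ 2 * (τ + p)) := by nlinarith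
  have h6 := lt_of_mul_lt_mul_left h5 (by positivity : 0 ≤ 4 * τ)
  rw [hDdef] at h6
  linarith

lemma strictMonoOn_persistenceBound {τ : ℝ} (hτ : 0 < τ) :
    StrictMonoOn (fun p : ℝ => 2 * p * (√(τ * (p + 2 * τ)) - τ)) (Ici 0) := by
  intro p hp q hq hpq
  have hp : 0 ≤ p := hp
  have h1 : √(τ * (p + 2 * τ)) ≤ √(τ * (q + 2 * τ)) := by gcongr
  have h2 : τ < √(τ * (p + 2 * τ)) := by
    rw [Real.lt_sqrt hτ.le]; nlinarith
  exact mul_lt_mul (by linarith) (by linarith) (by linarith) (by linarith)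

/-- `lam` is the preimage of `κ²` under the increasing function `φ`. Two candidates have the same
positive strict upper bounds; testing the larger one shows they agree. -/
lemma existsUnique_isPersistenceLowerBound {τ κ : ℝ} (hτ : 0 < τ) (hκ : 0 ≤ κ) :
    ∃! lam : ℝ, IsPersistenceLowerBound τ κ lam := by
  have hmono := strictMonoOn_persistenceBound hτ
  set φ : ℝ → ℝ := fun p => 2 * p * (√(τ * (p + 2 * τ)) - τ) with hφ
  have hcont : Continuous φ := by
    have : Continuous fun p : ℝ => √(τ * (p + 2 * τ)) := Real.continuous_sqrt.comp (by fun_prop)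
    fun_prop
  have hP : 0 ≤ 2 * κ ^ 2 / τ := by positivity
  have hκP : κ ^ 2 ∈ Icc (φ 0) (φ (2 * κ ^ 2 / τ)) := by
    refine ⟨by simp [hφ, sq_nonneg], ?_⟩
    -- Since `(5/4)² ≤ 2`, the bracket in `φ` is at least `τ/4`, so `2κ²/τ` is a large enough right
    -- endpoint.
    have h1 : 5 / 4 * τ ≤ √(τ * (2 * κ ^ 2 / τ + 2 * τ)) := by
      apply Real.le_sqrt_of_sq_le
      have : 0 ≤ τ * (2 * κ ^ 2 / τ) := by positivity
      nlinarith
    calc κ ^ 2 = 2 * (2 * κ ^ 2 / τ) * (5 / 4 * τ - τ) := by field_simp; ring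
      _ ≤ φ (2 * κ ^ 2 / τ) := by simp only [hφ]; gcongr
  obtain ⟨lam, hlam, hlamκ⟩ := intermediate_value_Icc hP hcont.continuousOn hκP
  refine ⟨lam, ⟨hlam.1, fun p hp => ?_⟩, ?_⟩
  · rw [Real.lt_sqrt hκ, ← hlamκ]
    exact hmono.lt_iff_lt hlam.1 hp.le
  · rintro μ ⟨hμ0, hμ⟩
    have hiff : ∀ p : ℝ, 0 < p → (lam < p ↔ μ < p) := fun p hp => by
      rw [← hμ p hp, Real.lt_sqrt hκ, ← hlamκ]
      exact (hmono.lt_iff_lt hlam.1 hp.le).symm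
    rcases lt_trichotomy μ lam with hlt | heq | hlt
    · exact absurd ((hiff lam (hμ0.trans_lt hlt)).2 hlt) (lt_irrefl _)
    · exact heq
    · exact absurd ((hiff μ (hlam.1.trans_lt hlt)).1 hlt) (lt_irrefl _)

variable {n : ℕ} {M : Set (EuclideanSpace ℝ (Fin n))} {τ : ℝ}

lemma mem_openEllipsoid_iff (hτ : 0 < τ) (hreach : reach M = ENNReal.ofReal τ) {p : ℝ}
    {x y : EuclideanSpace ℝ (Fin n)} :
    y ∈ openEllipsoid M p x ↔
      ‖(tangentDirections M x).starProjection (y - x)‖ ^ 2 / (τ * p + p ^ 2)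
        + ‖(normalDirections M x).starProjection (y - x)‖ ^ 2 / p ^ 2 < 1 := by
  rw [openEllipsoid, hreach, if_neg ENNReal.ofReal_ne_top, ENNReal.toReal_ofReal hτ.le,
    mem_ofPred_eq]

end Ellipsoids

theorem mainTheorem6 (n m : ℕ) (M S : Set (EuclideanSpace ℝ (Fin n)))
    (hM_nonempty : M.Nonempty) (hM_closed : IsClosed M) (hM : IsC1Submanifold m M)
    (τ : ℝ) (hτ_pos : 0 < τ) (hτ : reach M = ENNReal.ofReal τ)
    (hS_nonempty : S.Nonempty) (hSM : S ⊆ M) (hS : IsLocallyFiniteSet S)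
    (κ : ℝ) (hκ_finite : Metric.hausdorffEDist M S ≠ ∞) (hκ : κ = Metric.hausdorffDist M S) :
    (∃! lam : ℝ, IsPersistenceLowerBound τ κ lam) ∧
    ∀ lam p : ℝ, IsPersistenceLowerBound τ κ lam → lam < p → p < τ →
      M ⊆ ellipsoidUnion M S p ∧
      ellipsoidUnion M S p ⊆ (medialAxis M)ᶜ ∧
      ellipsoidUnion M S p ⊆ Metric.thickening τ M := by
  have hκ0 : 0 ≤ κ := hκ ▸ Metric.hausdorffDist_nonneg
  have hmed : ∀ q ∈ medialAxis M, τ ≤ Metric.infDist q M := fun q hq =>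
    le_infDist_of_mem_medialAxis hM_nonempty hτ hq
  refine ⟨existsUnique_isPersistenceLowerBound hτ_pos hκ0, fun lam p hlam hp hpτ => ?_⟩
  have hp0 : 0 < p := hlam.1.trans_lt hp
  have htube : ∀ y ∈ ellipsoidUnion M S p, Metric.infDist y M < τ := by
    intro y hy
    obtain ⟨x, hxS, hyx⟩ := mem_iUnion₂.1 hy
    rw [mem_openEllipsoid_iff hτ_pos hτ] at hyx
    refine infDist_lt_of_normal_bound hM_closed hM hmed hτ_pos (hSM hxS) ?_
    rw [norm_sq_eq_tangent_add_normal (M := M) x (y - x)]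
    exact sq_add_lt_of_ellipse hp0 hpτ hyx
  refine ⟨fun y hy => ?_, fun y hy hmem => absurd (htube y hy) (hmed y hmem).not_gt, fun y hy => ?_⟩
  · have h1 := Metric.infDist_le_hausdorffDist_of_mem hy hκ_finite
    rw [← hκ] at h1
    have h2 := (hlam.2 p hp0).2 hp
    -- The strict inequality yields a sample point without the infimum having to be attained.
    obtain ⟨x, hxS, hyx⟩ := (Metric.infDist_lt_iff hS_nonempty).1 (h1.trans_lt h2)
    rw [dist_eq_norm, Real.lt_sqrt (norm_nonneg _)] at hyx
    have hxM := hSM hxS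
    have h3 := norm_normal_starProjection_le hM_closed hM hmed hτ_pos hxM hy
    rw [norm_sq_eq_tangent_add_normal (M := M) x (y - x)] at h3 hyx
    exact mem_iUnion₂.2 ⟨x, hxS, (mem_openEllipsoid_iff hτ_pos hτ).2
      (ellipse_of_sq_lt hτ_pos hp0 (norm_nonneg _) h3 hyx)⟩
  · exact Metric.mem_thickening_iff_infDist_lt hM_nonempty |>.2 (htube y hy)
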